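/- Let $G$ be a finite simple graph with vertex set $V$, and let $\mathbf{k}$ be a field. Let $\mathrm{ind}(G)$ be the simplicial complex on $V$ whose faces are the independent sets of $G$ (including $\emptyset$), let $\dim \mathrm{ind}(G)$ be the largest cardinality of an independent set minus $1$, and let $\tilde H_k(\mathrm{ind}(G))$ denote its reduced simplicial homology with coefficients in $\mathbf{k}$, for $k\in\mathbb{Z}$ (the empty face spans the chains of degree $-1$). For $A\subseteq V$ let $\gamma_0(A,G)$ be the least cardinality of a set $X\subseteq V$ such that every vertex of $A$ is adjacent to some vertex of $X$, with $\gamma_0(A,G)=\infty$ if there is no such $X$ (that is, if $A$ contains an isolated vertex of $G$). Put $$\tau(G)=\max\{\gamma_0(A,G) : A\subseteq V \text{ is independent}\}\in\mathbb{N}\cup\{\infty\}.$$ Then: 1. $\tilde H_k(\mathrm{ind}(G))=0$ for all integers $k<\tau(G)-1$ (so for all $k$ if $\tau(G)=\infty$). 2. If $m\ge 2$ and $G$ has no induced subgraph isomorphic to $K_{1,m}$, then $\tilde H_k(\mathrm{ind}(G))=0$ for all integers $$k\le\left\lceil\frac{\dim \mathrm{ind}(G)-2m+3}{m-1}\right\rceil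 .$$ 3. If $A\subseteq V$ and any two distinct vertices of $A$ are at distance at least $3$ in $G$ (vertices in different components being at distance $\infty$), then $\tilde H_k(\mathrm{ind}(G))=0$ for all integers $k\le |A|-2$. -/

import Mathlib

/-! ### Reduced simplicial homology of an abstract simplicial complex -/

namespace PreAbstractSimplicialComplex

variable {V : Type*}

/-- The faces of `K` together with the empty face (Mathlib's complexes list only the nonempty
faces; reduced homology also uses the empty face, in degree `-1`). -/
def augmentedFaces (K : PreAbstractSimplicialComplex V) : Set (Finset V) :=
  {F | F = ∅ ∨ F ∈ K.faces}

/-- The dimension of `K`: the largest number of vertices of a face, minus one. The complex whose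
only face is the empty one has dimension `-1`. -/
noncomputable def dim (K : PreAbstractSimplicialComplex V) : ℤ :=
  ((sSup (Finset.card '' K.augmentedFaces) : ℕ) : ℤ) - 1

section Homology

variable (𝕜 : Type*) [Field 𝕜]

/-- The reduced `k`-chains of `K` over `𝕜`: the linear combinations of faces with exactly `k + 1`
vertices, inside the free vector space on all finite sets of vertices. -/
def reducedChains (K : PreAbstractSimplicialComplex V) (k : ℤ) : Submodule 𝕜 (Finset V →₀ 𝕜) :=
  Finsupp.supported 𝕜 𝕜 {F | F ∈ K.augmentedFaces ∧ (F.card : ℤ) = k + 1}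

variable [LinearOrder V]

/-- The sign `(-1) ^ r`, where `r` is the number of elements of `F` preceding `v`. -/
def faceSign (F : Finset V) (v : V) : 𝕜 :=
  (-1) ^ (F.filter (fun u => u < v)).card

/-- The simplicial boundary, `∂ F = ∑ v ∈ F, ± (F ∖ {v})`, extended linearly. In particular the
boundary of a single vertex is the empty face (the augmentation). -/
noncomputable def boundary : (Finset V →₀ 𝕜) →ₗ[𝕜] (Finset V →₀ 𝕜) :=
  Finsupp.linearCombination 𝕜
    (fun F => ∑ v ∈ F, Finsupp.single (F.erase v) (faceSign 𝕜 F v))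

/-- Reduced `k`-cycles: the kernel of `∂` on `k`-chains. -/
noncomputable def reducedCycles (K : PreAbstractSimplicialComplex V) (k : ℤ) :
    Submodule 𝕜 (Finset V →₀ 𝕜) :=
  K.reducedChains 𝕜 k ⊓ LinearMap.ker (boundary 𝕜)

/-- Reduced `k`-boundaries: the image under `∂` of the `(k+1)`-chains. -/
noncomputable def reducedBoundaries (K : PreAbstractSimplicialComplex V) (k : ℤ) :
    Submodule 𝕜 (Finset V →₀ 𝕜) :=
  (K.reducedChains 𝕜 (k + 1)).map (boundary 𝕜)

/-- The quotient `Z / (Z ∩ B)` of a submodule `Z` by a submodule `B` (which will lie in `Z`). -/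
abbrev SubmoduleQuotient {M : Type*} [AddCommGroup M] [Module 𝕜 M] (Z B : Submodule 𝕜 M) :
    Type _ :=
  Z ⧸ B.submoduleOf Z

/-- The reduced simplicial homology `H̃_k(K; 𝕜)`, cycles modulo boundaries. -/
abbrev ReducedHomology (K : PreAbstractSimplicialComplex V) (k : ℤ) : Type _ :=
  SubmoduleQuotient 𝕜 (K.reducedCycles 𝕜 k) (K.reducedBoundaries 𝕜 k)

theorem boundary_single (F : Finset V) :
    boundary 𝕜 (Finsupp.single F 1) =
      ∑ v ∈ F, Finsupp.single (F.erase v) (faceSign 𝕜 F v) := by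
  simp [boundary]

theorem faceSign_swap_of_lt (F : Finset V) {u v : V} (hv : v ∈ F) (h : v < u) :
    faceSign 𝕜 F v * faceSign 𝕜 (F.erase v) u + faceSign 𝕜 F u * faceSign 𝕜 (F.erase u) v = 0 := by
  have h1 : (F.erase u).filter (fun w => w < v) = F.filter (fun w => w < v) := by
    ext w
    simp only [Finset.mem_filter, Finset.mem_erase]
    constructor
    · tauto
    · rintro ⟨a, b⟩
      exact ⟨⟨(b.trans h).ne, a⟩, b⟩
  have h2 : (F.filter (fun w => w < u)).card
      = ((F.erase v).filter (fun w => w < u)).card + 1 := by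
    have h3 : (F.erase v).filter (fun w => w < u) = (F.filter (fun w => w < u)).erase v := by
      ext w
      simp only [Finset.mem_filter, Finset.mem_erase]
      tauto
    rw [h3, Finset.card_erase_add_one]
    simp [hv, h]
  unfold faceSign
  rw [h1, h2]
  ring

theorem faceSign_swap (F : Finset V) {u v : V} (hu : u ∈ F) (hv : v ∈ F) (h : v ≠ u) :
    faceSign 𝕜 F v * faceSign 𝕜 (F.erase v) u + faceSign 𝕜 F u * faceSign 𝕜 (F.erase u) v = 0 := by
  rcases lt_or_gt_of_ne h with h | h
  · exact faceSign_swap_of_lt 𝕜 F hv h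
  · rw [add_comm]
    exact faceSign_swap_of_lt 𝕜 F hu h

/-- `∂ ∘ ∂ = 0`. -/
theorem boundary_comp_boundary :
    (boundary 𝕜 : (Finset V →₀ 𝕜) →ₗ[𝕜] (Finset V →₀ 𝕜)) ∘ₗ boundary 𝕜 = 0 := by
  refine Finsupp.lhom_ext' fun F => LinearMap.ext_ring ?_
  simp only [LinearMap.comp_apply, Finsupp.lsingle_apply, boundary_single, map_sum,
    LinearMap.zero_apply]
  have h : ∀ v ∈ F, boundary 𝕜 (Finsupp.single (F.erase v) (faceSign 𝕜 F v)) =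
      ∑ u ∈ F.erase v,
        Finsupp.single ((F.erase v).erase u) (faceSign 𝕜 F v * faceSign 𝕜 (F.erase v) u) := by
    intro v _
    rw [← mul_one (faceSign 𝕜 F v), ← smul_eq_mul, ← Finsupp.smul_single, map_smul,
      boundary_single, Finset.smul_sum]
    simp
  rw [Finset.sum_congr rfl h, Finset.sum_sigma']
  refine Finset.sum_involution (fun p _ => ⟨p.2, p.1⟩) ?_ ?_ ?_ ?_
  · rintro ⟨v, u⟩ hp
    simp only [Finset.mem_sigma, Finset.mem_erase] at hp
    rw [Finset.erase_right_comm, ← Finsupp.single_add,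
      faceSign_swap 𝕜 F hp.2.2 hp.1 (Ne.symm hp.2.1), Finsupp.single_zero]
  · rintro ⟨v, u⟩ hp _ he
    simp only [Finset.mem_sigma, Finset.mem_erase] at hp
    simp only [Sigma.mk.injEq] at he
    exact hp.2.1 he.1
  · rintro ⟨v, u⟩ hp
    simp only [Finset.mem_sigma, Finset.mem_erase] at hp ⊢
    exact ⟨hp.2.2, Ne.symm hp.2.1, hp.1⟩
  · rintro ⟨v, u⟩ _
    rfl

/-- A boundary is a cycle. -/
theorem reducedBoundaries_le_reducedCycles (K : PreAbstractSimplicialComplex V) (k : ℤ) :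
    K.reducedBoundaries 𝕜 k ≤ K.reducedCycles 𝕜 k := by
  rintro _ ⟨x, hx, rfl⟩
  refine ⟨?_, LinearMap.congr_fun (boundary_comp_boundary 𝕜) x⟩
  rw [SetLike.mem_coe, reducedChains, Finsupp.mem_supported] at hx
  rw [SetLike.mem_coe, boundary, Finsupp.linearCombination_apply]
  refine Submodule.sum_mem _ fun F hF => Submodule.smul_mem _ _ (Submodule.sum_mem _ fun v hv => ?_)
  refine Finsupp.single_mem_supported 𝕜 _ ⟨?_, ?_⟩
  · rcases (hx hF).1 with h | h
    · simp [h] at hv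
    · rcases (F.erase v).eq_empty_or_nonempty with h' | h'
      · exact Or.inl h'
      · exact Or.inr ((K.isRelLowerSet_faces h).2 (Finset.erase_subset v F) h')
  · have h := (hx hF).2
    have h' := Finset.card_erase_add_one hv
    omega

end Homology

end PreAbstractSimplicialComplex

/-! ### Independence complex and strong domination of independent sets -/

namespace SimpleGraph

variable {V : Type*} (G : SimpleGraph V)

/-- The independence complex `ind(G)`: the simplicial complex on the vertex set of `G` whose faces
are the independent sets of `G`. -/
def independenceComplex : AbstractSimplicialComplex V where
  faces := {F | F.Nonempty ∧ G.IsIndepSet (F : Set V)}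
  isRelLowerSet_faces := fun {_} hF =>
    ⟨hF.1, fun _ hts ht => ⟨ht, hF.2.mono (Finset.coe_subset.mpr hts)⟩⟩
  singleton_mem v := by simp

/-- `γ₀(A, G)`: the least cardinality of a set `X` of vertices such that every vertex of `A` is
adjacent to some vertex of `X`. It is `⊤` when there is no such `X`, that is, when `A` contains an
isolated vertex of `G`. -/
noncomputable def strongDominationNum (A : Finset V) : ℕ∞ :=
  ⨅ (X : Finset V) (_ : ∀ a ∈ A, ∃ x ∈ X, G.Adj x a), (X.card : ℕ∞)

/-- `τ(G)`: the maximum of `γ₀(A, G)` over all independent sets `A` of vertices. -/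
noncomputable def tau : ℕ∞ :=
  ⨆ (A : Finset V) (_ : G.IsIndepSet (A : Set V)), G.strongDominationNum A

end SimpleGraph

open PreAbstractSimplicialComplex

/-! ### Cones, links and deletions in simplicial chains. -/

section Cone

variable {V : Type*} [LinearOrder V] (𝕜 : Type*) [Field 𝕜]

/-! All three claims follow from one fact: if an independent set `A` is not dominated by any `k + 1`
vertices, then `H̃_k(ind(G)) = 0`. This is `isAcyclicAt_indepSets`, by induction on the vertex set.
Pick `a ∈ A`. If `a` is isolated, the complex is a cone with apex `a`. Otherwise take a neighbour
`u` of `a`. Deleting `u` keeps `A` undominated. The link of `u` is the independence complex off the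
closed neighbourhood of `u`; there the part of `A` not adjacent to `u` resists one vertex fewer,
since `u` itself dominates the rest. `isAcyclicAt_of_deletion_of_link` combines the two.

For claims 2 and 3, a single vertex dominates at most `r` elements of `A` (`r = m - 1` and `r = 1`
respectively), so `|X| * r < |A|` prevents `X` from dominating `A`. -/

theorem faceSign_mul_self (F : Finset V) (v : V) : faceSign 𝕜 F v * faceSign 𝕜 F v = 1 := by
  rw [faceSign, ← mul_pow]
  simp

/-- The cone operator with apex `u`: it sends a face `F` not containing `u` to `± (F ∪ {u})`, and
a face containing `u` to `0`. -/
noncomputable def coneMap (u : V) : (Finset V →₀ 𝕜) →ₗ[𝕜] (Finset V →₀ 𝕜) :=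
  Finsupp.linearCombination 𝕜
    (fun F => if u ∈ F then 0 else Finsupp.single (insert u F) (faceSign 𝕜 (insert u F) u))

theorem coneMap_single (u : V) (F : Finset V) (c : 𝕜) :
    coneMap 𝕜 u (Finsupp.single F c) =
      if u ∈ F then 0 else Finsupp.single (insert u F) (c * faceSign 𝕜 (insert u F) u) := by
  split_ifs with h <;> simp [coneMap, h]

theorem boundary_single_smul (F : Finset V) (c : 𝕜) :
    boundary 𝕜 (Finsupp.single F c) =
      ∑ v ∈ F, Finsupp.single (F.erase v) (c * faceSign 𝕜 F v) := by
  simp [boundary, Finset.smul_sum]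

/-- The cone operator is a contracting homotopy of the full simplex. -/
theorem boundary_coneMap_add (u : V) (x : Finset V →₀ 𝕜) :
    boundary 𝕜 (coneMap 𝕜 u x) + coneMap 𝕜 u (boundary 𝕜 x) = x := by
  suffices h : boundary 𝕜 ∘ₗ coneMap 𝕜 u + coneMap 𝕜 u ∘ₗ boundary 𝕜 = LinearMap.id from
    LinearMap.congr_fun h x
  refine Finsupp.lhom_ext' fun F => LinearMap.ext_ring ?_
  simp only [LinearMap.comp_apply, LinearMap.add_apply, Finsupp.lsingle_apply, LinearMap.id_apply,
    boundary_single, map_sum, coneMap_single]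
  by_cases hu : u ∈ F
  · rw [if_pos hu, map_zero, zero_add, Finset.sum_eq_single_of_mem u hu]
    · simp [Finset.insert_erase hu, faceSign_mul_self]
    · intro v _ hv
      simp [hu, hv.symm]
  · rw [if_neg hu, boundary_single_smul, Finset.sum_insert hu, add_assoc,
      ← Finset.sum_add_distrib, Finset.sum_eq_zero, add_zero]
    · simp [Finset.erase_insert hu, faceSign_mul_self]
    · intro v hv
      have hvu : u ≠ v := fun h => hu (h ▸ hv)
      -- The cross terms erase `v` and insert `u` in either order; they cancel because `∂ ∘ ∂ = 0`
      -- on `insert u F`, up to signs that square to `1`.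
      have h := faceSign_swap 𝕜 (insert u F) (Finset.mem_insert_self u F)
        (Finset.mem_insert_of_mem hv) hvu.symm
      rw [Finset.erase_insert hu] at h
      rw [if_neg (by simp [hu]), ← Finset.erase_insert_of_ne hvu, ← Finsupp.single_add,
        Finsupp.single_eq_zero]
      have h1 := faceSign_mul_self 𝕜 (insert u F) u
      have h2 := faceSign_mul_self 𝕜 ((insert u F).erase v) u
      linear_combination (faceSign 𝕜 (insert u F) u * faceSign 𝕜 ((insert u F).erase v) u) * h
        - (faceSign 𝕜 F v * faceSign 𝕜 ((insert u F).erase v) u) * h1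
        - (faceSign 𝕜 (insert u F) u * faceSign 𝕜 (insert u F) v) * h2

theorem coneMap_mem_supported {u : V} {s t : Set (Finset V)} {x : Finset V →₀ 𝕜}
    (hx : x ∈ Finsupp.supported 𝕜 𝕜 s) (h : ∀ F ∈ s, u ∉ F → insert u F ∈ t) :
    coneMap 𝕜 u x ∈ Finsupp.supported 𝕜 𝕜 t := by
  rw [coneMap, Finsupp.linearCombination_apply]
  refine Submodule.sum_mem _ fun F hF => Submodule.smul_mem _ _ ?_
  split_ifs with hu
  · exact Submodule.zero_mem _
  · exact Finsupp.single_mem_supported 𝕜 _ (h F ((Finsupp.mem_supported 𝕜 x).1 hx hF) hu)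

theorem coneMap_eq_zero {u : V} {x : Finset V →₀ 𝕜}
    (hx : x ∈ Finsupp.supported 𝕜 𝕜 {F | u ∈ F}) : coneMap 𝕜 u x = 0 := by
  have h := coneMap_mem_supported (t := ∅) 𝕜 hx fun F hF hu => (hu hF).elim
  simpa using h

theorem boundary_mem_supported {s t : Set (Finset V)} {x : Finset V →₀ 𝕜}
    (hx : x ∈ Finsupp.supported 𝕜 𝕜 s) (h : ∀ F ∈ s, ∀ v ∈ F, F.erase v ∈ t) :
    boundary 𝕜 x ∈ Finsupp.supported 𝕜 𝕜 t := by
  rw [boundary, Finsupp.linearCombination_apply]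
  refine Submodule.sum_mem _ fun F hF => Submodule.smul_mem _ _ (Submodule.sum_mem _ fun v hv => ?_)
  exact Finsupp.single_mem_supported 𝕜 _ (h F ((Finsupp.mem_supported 𝕜 x).1 hx hF) v hv)

/-- Every cycle on faces with `c` vertices of the family `Δ` bounds a chain on faces with `c + 1`
vertices. -/
def IsAcyclicAt (Δ : Set (Finset V)) (c : ℕ) : Prop :=
  ∀ z ∈ Finsupp.supported 𝕜 𝕜 {F | F ∈ Δ ∧ F.card = c}, boundary 𝕜 z = 0 →
    ∃ w ∈ Finsupp.supported 𝕜 𝕜 {F | F ∈ Δ ∧ F.card = c + 1}, boundary 𝕜 w = z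

/-- Coning a cycle with apex `u` fills it. Only faces with `c` vertices are constrained, so for `c =
0` any vertex of the complex will do. -/
theorem isAcyclicAt_of_insert_mem {Δ : Set (Finset V)} {c : ℕ} (u : V)
    (h : ∀ F ∈ Δ, F.card = c → insert u F ∈ Δ) : IsAcyclicAt 𝕜 Δ c := by
  intro z hz hz0
  refine ⟨coneMap 𝕜 u z, coneMap_mem_supported 𝕜 hz ?_, ?_⟩
  · rintro F ⟨hF, hc⟩ hu
    exact ⟨h F hF hc, by rw [Finset.card_insert_of_notMem hu, hc]⟩
  · simpa [hz0] using boundary_coneMap_add 𝕜 u z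

/-- The Mayer–Vietoris argument for a vertex: acyclicity of the deletion and of the link of `u`
gives acyclicity of `Δ`. -/
theorem isAcyclicAt_of_deletion_of_link {Δ : Set (Finset V)} (hΔ : IsLowerSet Δ) {c : ℕ} (u : V)
    (hdel : IsAcyclicAt 𝕜 {F | F ∈ Δ ∧ u ∉ F} (c + 1))
    (hlink : IsAcyclicAt 𝕜 {F | insert u F ∈ Δ ∧ u ∉ F} c) : IsAcyclicAt 𝕜 Δ (c + 1) := by
  classical
  intro z hz hz0
  have hsum := Finsupp.filter_add_filter_not z (fun F => u ∈ F)
  set y := z.filter (fun F => u ∈ F) with hy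
  set x := z.filter (fun F => ¬ u ∈ F) with hx
  have hys : y ∈ Finsupp.supported 𝕜 𝕜 {F | (F ∈ Δ ∧ F.card = c + 1) ∧ u ∈ F} := by
    rw [Finsupp.mem_supported] at hz ⊢
    intro F hF
    simp only [hy, Finsupp.support_filter, Finset.coe_filter] at hF
    exact ⟨hz hF.1, hF.2⟩
  have hxs : x ∈ Finsupp.supported 𝕜 𝕜 {F | (F ∈ Δ ∧ F.card = c + 1) ∧ u ∉ F} := by
    rw [Finsupp.mem_supported] at hz ⊢
    intro F hF
    simp only [hx, Finsupp.support_filter, Finset.coe_filter] at hF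
    exact ⟨hz hF.1, hF.2⟩
  have hyx : boundary 𝕜 y = -boundary 𝕜 x := by
    rw [eq_neg_iff_add_eq_zero, ← map_add, hsum, hz0]
  have hyl : boundary 𝕜 y ∈
      Finsupp.supported 𝕜 𝕜 {F | F ∈ {F | insert u F ∈ Δ ∧ u ∉ F} ∧ F.card = c} := by
    have h1 : boundary 𝕜 y ∈ Finsupp.supported 𝕜 𝕜 {F | u ∉ F} := by
      rw [hyx]
      refine Submodule.neg_mem _ (boundary_mem_supported 𝕜 hxs fun F hF v _ hu => ?_)
      exact hF.2 (Finset.mem_of_mem_erase hu)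
    -- A face containing `u` loses `u` only when `u` is the vertex erased, and what remains lies in
    -- the link.
    have h2 : boundary 𝕜 y ∈
        Finsupp.supported 𝕜 𝕜 {F | u ∉ F → insert u F ∈ Δ ∧ F.card = c} := by
      refine boundary_mem_supported 𝕜 hys ?_
      rintro F ⟨⟨hF, hc⟩, huF⟩ v hv hu
      obtain rfl : u = v := by simpa [huF] using hu
      exact ⟨by rwa [Finset.insert_erase huF], by rw [Finset.card_erase_of_mem huF, hc]; rfl⟩
    rw [Finsupp.mem_supported] at h1 h2 ⊢
    exact fun F hF => ⟨⟨(h2 hF (h1 hF)).1, h1 hF⟩, (h2 hF (h1 hF)).2⟩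
  obtain ⟨w, hw, hwy⟩ := hlink _ hyl (LinearMap.congr_fun (boundary_comp_boundary 𝕜) y)
  -- Coning `∂ y = ∂ w` gives back `y`, so `z = x + y` is homologous to `x + w`, a cycle avoiding
  -- `u`.
  have hcone : boundary 𝕜 (coneMap 𝕜 u w) + y = w := by
    have h1 := boundary_coneMap_add 𝕜 u y
    rw [coneMap_eq_zero 𝕜 (Finsupp.supported_mono (fun F hF => hF.2) hys), map_zero,
      zero_add] at h1
    simpa [hwy, h1] using boundary_coneMap_add 𝕜 u w
  have hxw : x + w ∈ Finsupp.supported 𝕜 𝕜 {F | F ∈ {F | F ∈ Δ ∧ u ∉ F} ∧ F.card = c + 1} := by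
    refine Submodule.add_mem _ (Finsupp.supported_mono ?_ hxs) (Finsupp.supported_mono ?_ hw)
    · rintro F ⟨⟨hF, hc⟩, hu⟩
      exact ⟨⟨hF, hu⟩, hc⟩
    · rintro F ⟨⟨hF, hu⟩, hc⟩
      exact ⟨⟨hΔ (Finset.subset_insert u F) hF, hu⟩, hc⟩
  obtain ⟨t, ht, htx⟩ := hdel _ hxw (by rw [map_add, hwy, hyx, add_neg_cancel])
  refine ⟨t - coneMap 𝕜 u w, Submodule.sub_mem _ (Finsupp.supported_mono ?_ ht)
    (coneMap_mem_supported 𝕜 hw ?_), ?_⟩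
  · exact fun F hF => ⟨hF.1.1, hF.2⟩
  · rintro F ⟨⟨hF, -⟩, hc⟩ hu
    exact ⟨hF, by rw [Finset.card_insert_of_notMem hu, hc]⟩
  · rw [map_sub, htx, ← hsum, sub_eq_iff_eq_add]
    nth_rewrite 1 [← hcone]
    abel

end Cone

/-! ### Domination and the homology of independence complexes. -/

namespace SimpleGraph

theorem IsIndepSet.insert_iff {V : Type*} {G : SimpleGraph V} {s : Set V} {u : V} :
    G.IsIndepSet (insert u s) ↔ G.IsIndepSet s ∧ ∀ v ∈ s, ¬ G.Adj u v := by
  unfold SimpleGraph.IsIndepSet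
  rw [Set.pairwise_insert]
  refine and_congr_right fun _ => forall₂_congr fun v _ => ⟨fun h ha => (h ha.ne).1 ha,
    fun h _ => ⟨h, fun h' => h h'.symm⟩⟩

variable {V : Type*} [LinearOrder V] (G : SimpleGraph V) (𝕜 : Type*) [Field 𝕜]

/-- If no `c` vertices of `S` dominate the independent set `A ⊆ S`, then the independence complex
of the subgraph induced on `S` has no reduced homology in degree `c - 1`. -/
theorem isAcyclicAt_indepSets (S : Finset V) : ∀ (A : Finset V) (c : ℕ), A ⊆ S →
    G.IsIndepSet (A : Set V) →
    (∀ X ⊆ S, X.card ≤ c → ∃ a ∈ A, ∀ x ∈ X, ¬ G.Adj x a) →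
    IsAcyclicAt 𝕜 {F | F ⊆ S ∧ G.IsIndepSet (F : Set V)} c := by
  classical
  induction S using Finset.strongInduction with
  | H S ih =>
    intro A c hAS hA hdom
    obtain ⟨a, ha, -⟩ := hdom ∅ (Finset.empty_subset S) (Nat.zero_le c)
    rcases c with _ | c
    · refine isAcyclicAt_of_insert_mem 𝕜 a fun F _ hF => ?_
      rw [Finset.card_eq_zero] at hF
      subst hF
      exact ⟨by simpa using hAS ha, by simp⟩
    by_cases hiso : ∀ u ∈ S, ¬ G.Adj a u
    · refine isAcyclicAt_of_insert_mem 𝕜 a fun F hF _ => ⟨?_, ?_⟩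
      · exact Finset.insert_subset (hAS ha) hF.1
      · rw [Finset.coe_insert, IsIndepSet.insert_iff]
        exact ⟨hF.2, fun v hv => hiso v (hF.1 hv)⟩
    push Not at hiso
    obtain ⟨u, huS, hau⟩ := hiso
    have huA : u ∉ A := fun h => hA (Finset.mem_coe.2 ha) (Finset.mem_coe.2 h) hau.ne hau
    refine isAcyclicAt_of_deletion_of_link 𝕜 ?_ u ?_ ?_
    · exact fun F F' h hF => ⟨h.trans hF.1, hF.2.mono (Finset.coe_subset.2 h)⟩
    · have h := ih (S.erase u) (Finset.erase_ssubset huS) A (c + 1)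
        (fun x hx => Finset.mem_erase.2 ⟨fun h => huA (h ▸ hx), hAS hx⟩) hA
        (fun X hX => hdom X (hX.trans (Finset.erase_subset u S)))
      convert h using 1
      ext F
      simp only [Set.mem_ofPred_eq, Finset.subset_erase]
      tauto
    · have h := ih (S.filter fun v => v ≠ u ∧ ¬ G.Adj u v)
        (Finset.filter_ssubset.2 ⟨u, huS, by simp⟩) (A.filter fun v => ¬ G.Adj u v) c ?_
        (hA.mono (Finset.coe_subset.2 (Finset.filter_subset _ A))) ?_
      · convert h using 1
        ext F
        simp only [Set.mem_ofPred_eq, Finset.coe_insert, IsIndepSet.insert_iff,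
          Finset.subset_iff, Finset.forall_mem_insert, Finset.mem_filter, Finset.mem_coe]
        constructor
        · rintro ⟨⟨⟨-, h1⟩, h2, h3⟩, h4⟩
          exact ⟨fun v hv => ⟨h1 v hv, fun h => h4 (h ▸ hv), h3 v hv⟩, h2⟩
        · rintro ⟨h1, h2⟩
          exact ⟨⟨⟨huS, fun v hv => (h1 hv).1⟩, h2, fun v hv => (h1 hv).2.2⟩,
            fun h => (h1 h).2.1 rfl⟩
      · intro v hv
        rw [Finset.mem_filter] at hv ⊢
        exact ⟨hAS hv.1, fun h => huA (h ▸ hv.1), hv.2⟩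
      · intro X hX hXc
        -- Adding `u` to `X` uses up the extra vertex allowed, and forces the undominated `b` to be
        -- a non-neighbour of `u`.
        obtain ⟨b, hb, hXb⟩ := hdom (insert u X)
          (Finset.insert_subset huS (hX.trans (Finset.filter_subset _ S)))
          ((Finset.card_insert_le u X).trans (by omega))
        rw [Finset.forall_mem_insert] at hXb
        exact ⟨b, Finset.mem_filter.2 ⟨hb, hXb.1⟩, hXb.2⟩

theorem mem_augmentedFaces_independenceComplex {V : Type*} (G : SimpleGraph V) (F : Finset V) :
    F ∈ G.independenceComplex.augmentedFaces ↔ G.IsIndepSet (F : Set V) := by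
  rcases F.eq_empty_or_nonempty with rfl | h
  · simp [augmentedFaces]
  · simp [augmentedFaces, independenceComplex, h, h.ne_empty]

theorem subsingleton_reducedHomology_of_le (K : PreAbstractSimplicialComplex V) (k : ℤ)
    (h : K.reducedCycles 𝕜 k ≤ K.reducedBoundaries 𝕜 k) :
    Subsingleton (K.ReducedHomology 𝕜 k) := by
  exact Submodule.Quotient.subsingleton_iff.2 (Submodule.submoduleOf_eq_top.2 h)

/-- If no `k + 1` vertices dominate the independent set `A`, then `H̃_k(ind(G)) = 0`. -/
theorem subsingleton_reducedHomology_independenceComplex [Fintype V] (A : Finset V) (k : ℤ)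
    (hA : G.IsIndepSet (A : Set V))
    (hdom : ∀ X : Finset V, (X.card : ℤ) ≤ k + 1 → ∃ a ∈ A, ∀ x ∈ X, ¬ G.Adj x a) :
    Subsingleton (G.independenceComplex.ReducedHomology 𝕜 k) := by
  refine subsingleton_reducedHomology_of_le 𝕜 _ k ?_
  rintro z ⟨hz, hz0⟩
  rcases lt_or_ge (k + 1) 0 with hk | hk
  · have h : z ∈ Finsupp.supported 𝕜 𝕜 (∅ : Set (Finset V)) :=
      Finsupp.supported_mono (fun F hF => by have := hF.2; omega) hz
    obtain rfl : z = 0 := by simpa using h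
    exact Submodule.zero_mem _
  · obtain ⟨c, hc⟩ := Int.eq_ofNat_of_zero_le hk
    have h := G.isAcyclicAt_indepSets 𝕜 Finset.univ A c (Finset.subset_univ A) hA
      (fun X _ hX => hdom X (by omega))
    have hzs : z ∈ Finsupp.supported 𝕜 𝕜
        {F | F ∈ {F | F ⊆ Finset.univ ∧ G.IsIndepSet (F : Set V)} ∧ F.card = c} := by
      refine Finsupp.supported_mono ?_ hz
      rintro F ⟨hF, hFc⟩
      exact ⟨⟨Finset.subset_univ F, (G.mem_augmentedFaces_independenceComplex F).1 hF⟩, by omega⟩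
    obtain ⟨w, hw, rfl⟩ := h z hzs hz0
    refine ⟨w, Finsupp.supported_mono ?_ hw, rfl⟩
    rintro F ⟨⟨-, hF⟩, hFc⟩
    exact ⟨(G.mem_augmentedFaces_independenceComplex F).2 hF, by omega⟩

open Classical in
theorem exists_not_dominated_of_card_lt {V : Type*} (G : SimpleGraph V) {A X : Finset V} {r : ℕ}
    (hr : ∀ x, (A.filter (G.Adj x)).card ≤ r) (h : X.card * r < A.card) :
    ∃ a ∈ A, ∀ x ∈ X, ¬ G.Adj x a := by
  by_contra! hdom
  refine h.not_ge (le_trans (Finset.card_le_card ?_)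
    (Finset.card_biUnion_le_card_mul X (fun x => A.filter (G.Adj x)) r fun x _ => hr x))
  intro a ha
  obtain ⟨x, hx, hxa⟩ := hdom a ha
  exact Finset.mem_biUnion.2 ⟨x, hx, Finset.mem_filter.2 ⟨ha, hxa⟩⟩

-- The centre is `x` and the leaves are neighbours of `x` in `A`; independence of `A` makes the star
-- induced.
open Classical in
theorem nonempty_star_embedding {V : Type*} (G : SimpleGraph V) {A : Finset V} {x : V} {m : ℕ}
    (hA : G.IsIndepSet (A : Set V)) (h : m ≤ (A.filter (G.Adj x)).card) :
    Nonempty (completeBipartiteGraph (Fin 1) (Fin m) ↪g G) := by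
  obtain ⟨e⟩ : Nonempty (Fin m ↪ A.filter (G.Adj x)) :=
    Function.Embedding.nonempty_of_card_le (by simpa using h)
  have hadj : ∀ i, G.Adj x (e i) := fun i => (Finset.mem_filter.1 (e i).2).2
  have hnot : ∀ i j, ¬ G.Adj (e i) (e j) := fun i j hij =>
    hA (Finset.mem_coe.2 (Finset.mem_filter.1 (e i).2).1)
      (Finset.mem_coe.2 (Finset.mem_filter.1 (e j).2).1) hij.ne hij
  refine ⟨⟨⟨Sum.elim (fun _ => x) (fun i => (e i : V)), ?_⟩, ?_⟩⟩
  · refine Function.Injective.sumElim (Function.injective_of_subsingleton _)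
      (Subtype.val_injective.comp e.injective) fun _ i => (hadj i).ne
  · rintro (i | i) (j | j)
    · simp
    · simp [hadj]
    · simp [(hadj i).symm]
    · simp [hnot]

theorem exists_isIndepSet_card_eq_dim {V : Type*} [Fintype V] (G : SimpleGraph V) :
    ∃ A : Finset V, G.IsIndepSet (A : Set V) ∧ G.independenceComplex.dim = (A.card : ℤ) - 1 := by
  obtain ⟨A, hA, hAc⟩ := Nat.sSup_mem
    (s := Finset.card '' G.independenceComplex.augmentedFaces)
    ⟨_, Set.mem_image_of_mem _ (Or.inl rfl)⟩
    ⟨Fintype.card V, by rintro _ ⟨F, -, rfl⟩; exact F.card_le_univ⟩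
  refine ⟨A, ?_, by rw [PreAbstractSimplicialComplex.dim, ← hAc]⟩
  rcases hA with rfl | hA
  · simp
  · exact hA.2

end SimpleGraph

theorem corollary6p7 {V : Type*} [Fintype V] [LinearOrder V] (G : SimpleGraph V)
    (𝕜 : Type*) [Field 𝕜] :
    -- vanishing below `τ(G) - 1`
    (∀ k : ℤ, ((k + 1 : ℤ) : WithTop ℤ) < ENat.map (fun n : ℕ => (n : ℤ)) G.tau →
      Subsingleton (G.independenceComplex.ReducedHomology 𝕜 k)) ∧
    -- graphs with no induced `K_{1,m}`
    (∀ m : ℕ, 2 ≤ m →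
      ¬ Nonempty (completeBipartiteGraph (Fin 1) (Fin m) ↪g G) →
      ∀ k : ℤ, k ≤ ⌈((G.independenceComplex.dim : ℚ) - 2 * (m : ℚ) + 3) / ((m : ℚ) - 1)⌉ →
        Subsingleton (G.independenceComplex.ReducedHomology 𝕜 k)) ∧
    -- vertices at pairwise distance at least `3`
    (∀ A : Finset V, (A : Set V).Pairwise (fun u v => 3 ≤ G.edist u v) →
      ∀ k : ℤ, k ≤ (A.card : ℤ) - 2 →
        Subsingleton (G.independenceComplex.ReducedHomology 𝕜 k)) := by
  classical
  refine ⟨fun k hk => ?_, fun m hm hfree k hk => ?_, fun A hA k hk => ?_⟩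
  · rcases lt_or_ge (k + 1) 0 with hneg | hpos
    · exact G.subsingleton_reducedHomology_independenceComplex 𝕜 ∅ k (by simp)
        fun X hX => by omega
    · obtain ⟨c, hc⟩ := Int.eq_ofNat_of_zero_le hpos
      have hlt : (c : ℕ∞) < G.tau := by
        rw [hc] at hk
        cases h : G.tau with
        | top => exact ENat.natCast_lt_top c
        | coe n =>
          rw [h, ENat.map_natCast, WithTop.coe_lt_coe] at hk
          exact_mod_cast hk
      simp only [SimpleGraph.tau, lt_iSup_iff] at hlt
      obtain ⟨A, hA, hlt⟩ := hlt
      refine G.subsingleton_reducedHomology_independenceComplex 𝕜 A k hA fun X hX => ?_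
      by_contra! hdom
      refine hlt.not_ge ((iInf₂_le X hdom).trans ?_)
      exact_mod_cast (by omega : X.card ≤ c)
  · obtain ⟨A, hA, hdim⟩ := G.exists_isIndepSet_card_eq_dim
    refine G.subsingleton_reducedHomology_independenceComplex 𝕜 A k hA fun X hX => ?_
    refine G.exists_not_dominated_of_card_lt (r := m - 1) (fun x => ?_) ?_
    · by_contra! h
      exact hfree (G.nonempty_star_embedding (x := x) hA (by omega))
    · have hm1 : (0 : ℚ) < (m : ℚ) - 1 := by
        have : (2 : ℚ) ≤ m := by exact_mod_cast hm
        linarith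
      -- `k ≤ ⌈q⌉` means `k - 1 < q`; with `dim = |A| - 1` this rearranges to `(k + 1)(m - 1) <
      -- |A|`.
      rw [Int.le_ceil_iff, lt_div_iff₀ hm1, hdim] at hk
      have hXq : (X.card : ℚ) ≤ k + 1 := by exact_mod_cast hX
      have h : (X.card : ℚ) * ((m : ℚ) - 1) < A.card := by
        refine (mul_le_mul_of_nonneg_right hXq hm1.le).trans_lt ?_
        push_cast at hk
        linarith
      have hcast : ((m - 1 : ℕ) : ℚ) = (m : ℚ) - 1 := by
        rw [Nat.cast_sub (by omega), Nat.cast_one]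
      rw [← hcast] at h
      exact_mod_cast h
  · have hdist : ∀ u ∈ A, ∀ v ∈ A, ∀ p : G.Walk u v, p.length ≤ 2 → u = v := by
      intro u hu v hv p hp
      by_contra huv
      have h := (hA hu hv huv).trans (SimpleGraph.edist_le p)
      have h' : 3 ≤ p.length := by exact_mod_cast h
      omega
    refine G.subsingleton_reducedHomology_independenceComplex 𝕜 A k ?_ fun X hX => ?_
    · intro u hu v hv huv hadj
      exact huv (hdist u hu v hv hadj.toWalk (by simp))
    · refine G.exists_not_dominated_of_card_lt (r := 1) (fun x => ?_) (by omega)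
      refine Finset.card_le_one.2 fun u hu v hv => ?_
      rw [Finset.mem_filter] at hu hv
      -- Two elements of `A` with a common neighbour `x` are joined by a walk of length `2`.
      exact hdist u hu.1 v hv.1 (.cons hu.2.symm (.cons hv.2 .nil)) (by simp)
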